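/- **Theorem 2.1.** Let $p\in[1,\infty)$, let $G$ be a locally compact group with left Haar measure $\mu$, let $A$ be an $L^p$ operator algebra (a complex Banach algebra admitting an isometric representation on the $L^p$ space of some measure space) that has a two-sided contractive approximate identity, and let $\alpha$ be a homomorphism from $G$ to the group of isometric automorphisms of $A$ such that $t\mapsto\alpha_t(a)$ is continuous for every $a\in A$. A nondegenerate $\sigma$-finite contractive covariant representation of $(G,A,\alpha)$ is a pair $(\pi,v)$ on a space $E=L^p(X,\nu)$ with $\nu$ $\sigma$-finite, where $\pi:A\to\mathcal B(E)$ is a contractive homomorphism that is nondegenerate (the linear span of $\pi(A)E$ is dense in $E$) and $v$ is a strongly continuous representation of $G$ by surjective linear isometries of $E$, such that $v_t\pi(a)v_{t^{-1}}=\pi(\alpha_t(a))$ for all $t\in G$, $a\in A$. Let $C_c(G,A,\alpha)$ be the algebra of continuous compactly supported functions $G\to A$ with product $(f*g)(t)=\int_G f(s)\alpha_s(g(s^{-1}t))\,d\mu(s)$, and put $(\pi\rtimes v)(f)\xi=\int_G\pi(f(t))v_t\xi\,d\mu(t)$ for $f\in C_c(G,A,\alpha)$, $\xi\in E$. The full crossed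 product $F^p(G,A,\alpha)$ is the (Hausdorff) completion of $C_c(G,A,\alpha)$ in the seminorm $\|f\|=\sup\|(\pi\rtimes v)(f)\|$, the supremum being over all nondegenerate $\sigma$-finite contractive covariant representations $(\pi,v)$; each $\pi\rtimes v$ extends by continuity to a contractive homomorphism on $F^p(G,A,\alpha)$, the integrated form of $(\pi,v)$, again denoted $\pi\rtimes v$. Then for every $\sigma$-finite measure space $(X,\nu)$ and every nondegenerate contractive homomorphism $L:F^p(G,A,\alpha)\to\mathcal B(L^p(X,\nu))$ there is a nondegenerate contractive covariant representation $(\pi,v)$ of $(G,A,\alpha)$ on the same space $L^p(X,\nu)$ with $L=\pi\rtimes v$. -/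

import Mathlib

open MeasureTheory Filter Topology
open scoped ENNReal CompactlySupported Pointwise

set_option linter.unusedSectionVars false

universe w u v x

/-- `A` is an `L^p` operator algebra: it has an isometric representation on the `L^p` space of
some (arbitrary) measure space. -/
def IsLpOperatorAlgebra.{x', v'} (p : ℝ≥0∞) [Fact (1 ≤ p)] (A : Type v') [NonUnitalNormedRing A]
    [NormedSpace ℂ A] : Prop :=
  ∃ (X : Type x') (_ : MeasurableSpace X) (ν : Measure X)
    (π : A →ₙₐ[ℂ] (Lp ℂ p ν →L[ℂ] Lp ℂ p ν)), ∀ a, ‖π a‖ = ‖a‖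

/-- `A` has a two-sided contractive approximate identity. -/
def HasContractiveApproxIdentity (A : Type*) [NonUnitalNormedRing A] : Prop :=
  ∃ l : Filter A, l.IsApproximateUnit ∧ ∀ᶠ e in l, ‖e‖ ≤ 1

/-- A continuous (for the point-norm topology) homomorphism from `G` to the group of isometric
algebra automorphisms of `A`. -/
structure IsometricAction (G A : Type*) [Group G] [TopologicalSpace G] [NonUnitalNormedRing A]
    [NormedSpace ℂ A] where
  aut : G →* (A ≃ₗᵢ[ℂ] A)
  aut_mul : ∀ (t : G) (a b : A), aut t (a * b) = aut t a * aut t b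
  continuous_aut : ∀ a : A, Continuous fun t => aut t a

section Nondegenerate

variable {B : Type*} [NonUnitalNormedRing B] [NormedSpace ℂ B]
  {E : Type*} [NormedAddCommGroup E] [NormedSpace ℂ E]

/-- A representation `π : B → 𝓑(E)` is nondegenerate if the linear span of
`{π(b)ξ : b ∈ B, ξ ∈ E}` is dense in `E`. -/
def IsNondegenerateRep (π : B →ₙₐ[ℂ] (E →L[ℂ] E)) : Prop :=
  Dense (Submodule.span ℂ {η : E | ∃ (b : B) (ξ : E), η = π b ξ} : Set E)

/-- A representation `π : B → 𝓑(E)` is contractive if `‖π(b)‖ ≤ ‖b‖` for all `b`. -/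
def IsContractiveRep (π : B →ₙₐ[ℂ] (E →L[ℂ] E)) : Prop :=
  ∀ b, ‖π b‖ ≤ ‖b‖

end Nondegenerate

/-- A strongly continuous isometric representation of a group is jointly continuous. -/
theorem continuous_uncurry_isometricRep {G E : Type*} [Group G] [TopologicalSpace G]
    [NormedAddCommGroup E] [NormedSpace ℂ E] (v : G →* (E ≃ₗᵢ[ℂ] E))
    (hv : ∀ ξ, Continuous fun t => v t ξ) : Continuous fun q : G × E => v q.1 q.2 := by
  rw [continuous_iff_continuousAt]
  rintro ⟨t₀, ξ₀⟩
  have h1 : Tendsto (fun q : G × E => ‖q.2 - ξ₀‖ + ‖v q.1 ξ₀ - v t₀ ξ₀‖) (𝓝 (t₀, ξ₀)) (𝓝 0) := by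
    have : Continuous fun q : G × E => ‖q.2 - ξ₀‖ + ‖v q.1 ξ₀ - v t₀ ξ₀‖ := by
      have := (hv ξ₀).comp (continuous_fst (X := G) (Y := E))
      simp only [Function.comp_def] at this
      fun_prop
    simpa using this.tendsto (t₀, ξ₀)
  rw [ContinuousAt, tendsto_iff_norm_sub_tendsto_zero]
  refine squeeze_zero (fun _ => norm_nonneg _) (fun q => ?_) h1
  calc ‖v q.1 q.2 - v t₀ ξ₀‖ = ‖v q.1 (q.2 - ξ₀) + (v q.1 ξ₀ - v t₀ ξ₀)‖ := by
        rw [map_sub]; congr 1; abel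
    _ ≤ ‖v q.1 (q.2 - ξ₀)‖ + ‖v q.1 ξ₀ - v t₀ ξ₀‖ := norm_add_le _ _
    _ = _ := by rw [LinearIsometryEquiv.norm_map]

namespace NonUnitalCompletion

open UniformSpace Completion

variable {R : Type*} [NonUnitalSeminormedRing R]

/-- The multiplication of a (not necessarily unital) seminormed ring, extended by continuity to
the completion. -/
noncomputable instance : Mul (Completion R) :=
  ⟨Function.curry <| (isDenseInducing_coe.prodMap isDenseInducing_coe).extend
    ((↑) ∘ Function.uncurry (· * ·))⟩

theorem coe_mul (a b : R) : ((a * b : R) : Completion R) = a * b :=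
  ((isDenseInducing_coe.prodMap isDenseInducing_coe).extend_eq
    ((continuous_coe R).comp (@continuous_mul R _ _ _)) (a, b)).symm

instance : ContinuousMul (Completion R) where
  continuous_mul := by
    let m := (AddMonoidHom.mul : R →+ R →+ R).compr₂ toCompl
    have : Continuous fun p : R × R => m p.1 p.2 := (continuous_coe R).comp continuous_mul
    have di : IsDenseInducing (toCompl : R → Completion R) := isDenseInducing_coe
    exact (di.extend_Z_bilin di this :)

noncomputable instance instRing : NonUnitalNormedRing (Completion R) :=
  { (inferInstance : NormedAddCommGroup (Completion R)), (inferInstance : Mul (Completion R)) with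
    zero_mul := fun a => Completion.induction_on a (isClosed_eq (by fun_prop) continuous_const)
      fun a => by rw [← coe_zero, ← coe_mul, zero_mul]
    mul_zero := fun a => Completion.induction_on a (isClosed_eq (by fun_prop) continuous_const)
      fun a => by rw [← coe_zero, ← coe_mul, mul_zero]
    mul_assoc := fun a b c => Completion.induction_on₃ a b c
      (isClosed_eq (by fun_prop) (by fun_prop))
      fun a b c => by rw [← coe_mul, ← coe_mul, ← coe_mul, ← coe_mul, mul_assoc]
    left_distrib := fun a b c => Completion.induction_on₃ a b c
      (isClosed_eq (by fun_prop) (by fun_prop))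
      fun a b c => by rw [← coe_add, ← coe_mul, ← coe_mul, ← coe_mul, ← coe_add, mul_add]
    right_distrib := fun a b c => Completion.induction_on₃ a b c
      (isClosed_eq (by fun_prop) (by fun_prop))
      fun a b c => by rw [← coe_add, ← coe_mul, ← coe_mul, ← coe_mul, ← coe_add, add_mul]
    norm_mul_le := fun a b => Completion.induction_on₂ a b
      (isClosed_le (by fun_prop) (by fun_prop))
      fun a b => by rw [← coe_mul]; simpa only [norm_coe] using norm_mul_le a b }

variable [NormedSpace ℂ R] [IsScalarTower ℂ R R] [SMulCommClass ℂ R R]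

instance : IsScalarTower ℂ (Completion R) (Completion R) where
  smul_assoc c a b := Completion.induction_on₂ a b
    (isClosed_eq (((continuous_const_smul c).comp continuous_fst).mul continuous_snd)
      ((continuous_const_smul c).comp continuous_mul))
    fun a b => by
      simp only [smul_eq_mul]
      rw [← coe_smul, ← coe_mul, ← coe_mul, ← coe_smul, smul_mul_assoc]

instance : SMulCommClass ℂ (Completion R) (Completion R) where
  smul_comm c a b := Completion.induction_on₂ a b
    (isClosed_eq ((continuous_const_smul c).comp continuous_mul)
      (continuous_fst.mul ((continuous_const_smul c).comp continuous_snd)))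
    fun a b => by
      simp only [smul_eq_mul]
      rw [← coe_smul, ← coe_mul, ← coe_mul, ← coe_smul, mul_smul_comm]

noncomputable abbrev instSpace (R : Type*) [NonUnitalSeminormedRing R] [NormedSpace ℂ R] :
    NormedSpace ℂ (Completion R) := inferInstance

/-- The canonical homomorphism from `R` to its completion. -/
noncomputable def coeHom : R →ₙₐ[ℂ] Completion R where
  toFun a := a
  map_smul' c a := coe_smul c a
  map_zero' := coe_zero
  map_add' a b := coe_add a b
  map_mul' a b := coe_mul a b

variable {S : Type*} [NonUnitalNormedRing S] [NormedSpace ℂ S] [CompleteSpace S]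

/-- The extension by continuity of a contractive homomorphism to the completion. -/
noncomputable def extendHom (T : R →ₙₐ[ℂ] S) (hT : ∀ a, ‖T a‖ ≤ ‖a‖) : Completion R →ₙₐ[ℂ] S :=
  let T' : R →L[ℂ] S := LinearMap.mkContinuous (T : R →ₗ[ℂ] S) 1 fun a => by simpa using hT a
  { T'.fromCompletion with
    map_zero' := map_zero T'.fromCompletion
    map_mul' := fun a b => Completion.induction_on₂ a b
      (isClosed_eq (T'.fromCompletion.continuous.comp continuous_mul)
        ((T'.fromCompletion.continuous.comp continuous_fst).mul
          (T'.fromCompletion.continuous.comp continuous_snd)))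
      fun a b => by
        change T'.fromCompletion (a * b) = T'.fromCompletion a * T'.fromCompletion b
        rw [← coe_mul]
        simp only [ContinuousLinearMap.fromCompletion_apply_coe]
        exact map_mul T a b }

theorem extendHom_coe (T : R →ₙₐ[ℂ] S) (hT : ∀ a, ‖T a‖ ≤ ‖a‖) (a : R) :
    extendHom T hT a = T a :=
  ContinuousLinearMap.fromCompletion_apply_coe _ a

theorem continuous_extendHom (T : R →ₙₐ[ℂ] S) (hT : ∀ a, ‖T a‖ ≤ ‖a‖) :
    Continuous (extendHom T hT) :=
  ContinuousLinearMap.continuous (ContinuousLinearMap.fromCompletion _)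

end NonUnitalCompletion

section CrossedProduct

variable {G : Type u} {A : Type v} [Group G] [TopologicalSpace G] [IsTopologicalGroup G]
  [LocallyCompactSpace G] [MeasurableSpace G] [BorelSpace G]
  [NonUnitalNormedRing A] [NormedSpace ℂ A] [IsScalarTower ℂ A A] [SMulCommClass ℂ A A]
  [CompleteSpace A]

namespace IsometricAction

theorem continuous_act (α : IsometricAction G A) {Y : Type*} [TopologicalSpace Y]
    {s : Y → G} {f : Y → A} (hs : Continuous s) (hf : Continuous f) :
    Continuous fun y => α.aut (s y) (f y) :=
  (continuous_uncurry_isometricRep α.aut α.continuous_aut).comp (hs.prodMk hf)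

end IsometricAction

/-- The space of continuous compactly supported functions `G → A`. The action `α` and the left
Haar measure `μ` are recorded in the type because the product below (twisted convolution) depends
on them. -/
@[nolint unusedArguments]
def TwistedCc (_α : IsometricAction G A) (_μ : Measure G) : Type _ := C_c(G, A)

namespace TwistedCc

variable {α : IsometricAction G A} {μ : Measure G}

noncomputable instance : AddCommGroup (TwistedCc α μ) := inferInstanceAs (AddCommGroup C_c(G, A))
noncomputable instance : Module ℂ (TwistedCc α μ) := inferInstanceAs (Module ℂ C_c(G, A))
instance : FunLike (TwistedCc α μ) G A := inferInstanceAs (FunLike C_c(G, A) G A)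

theorem continuous (f : TwistedCc α μ) : Continuous f :=
  ContinuousMap.continuous_toFun (CompactlySupportedContinuousMap.toContinuousMap (α := G) (β := A) f)

theorem hasCompactSupport (f : TwistedCc α μ) : HasCompactSupport f :=
  CompactlySupportedContinuousMap.hasCompactSupport' (α := G) (β := A) f

@[ext] theorem ext {f g : TwistedCc α μ} (h : ∀ t, f t = g t) : f = g :=
  DFunLike.ext f g h

@[simp] theorem add_apply (f g : TwistedCc α μ) (t : G) : (f + g) t = f t + g t := rfl
@[simp] theorem smul_apply (c : ℂ) (f : TwistedCc α μ) (t : G) : (c • f) t = c • f t := rfl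
@[simp] theorem zero_apply (t : G) : (0 : TwistedCc α μ) t = 0 := rfl

theorem eq_zero_of_notMem (f : TwistedCc α μ) {t : G} (ht : t ∉ tsupport f) : f t = 0 :=
  image_eq_zero_of_notMem_tsupport ht

theorem conv_kernel_eq_zero (f g : TwistedCc α μ) {s t : G}
    (h : t ∉ tsupport f * tsupport g) (hs : s ∈ tsupport f) : g (s⁻¹ * t) = 0 := by
  apply g.eq_zero_of_notMem
  intro h'
  exact h ⟨s, hs, s⁻¹ * t, h', by simp⟩

theorem integrable_of_factor [IsFiniteMeasureOnCompacts μ] {E : Type*} [NormedAddCommGroup E]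
    (f : TwistedCc α μ) {F : G → E} (hF : Continuous F) (h0 : ∀ t, f t = 0 → F t = 0) :
    Integrable F μ :=
  hF.integrable_of_hasCompactSupport
    (HasCompactSupport.intro f.hasCompactSupport fun t ht => h0 t (f.eq_zero_of_notMem ht))

variable [IsFiniteMeasureOnCompacts μ]

/-- Twisted convolution `(f * g)(t) = ∫ f(s) α_s(g(s⁻¹t)) dμ(s)`. -/
noncomputable instance : Mul (TwistedCc α μ) where
  mul f g :=
    { toFun := fun t => ∫ s, f s * α.aut s (g (s⁻¹ * t)) ∂μ
      continuous_toFun := by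
        rw [← continuousOn_univ]
        refine continuousOn_integral_of_compact_support (k := tsupport f) f.hasCompactSupport
          (Continuous.continuousOn ?_) ?_
        · have hf := f.continuous
          have hg := g.continuous
          have := α.continuous_act (s := fun q : G × G => q.2)
            (f := fun q : G × G => g (q.2⁻¹ * q.1)) (by fun_prop) (by fun_prop)
          simp only [Function.uncurry_def]
          fun_prop
        · intro t s _ hs
          simp [f.eq_zero_of_notMem hs]
      hasCompactSupport' := by
        refine HasCompactSupport.intro (f.hasCompactSupport.isCompact.mul g.hasCompactSupport) ?_
        intro t ht
        refine integral_eq_zero_of_ae (Eventually.of_forall fun s => ?_)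
        by_cases hs : s ∈ tsupport f
        · simp [conv_kernel_eq_zero f g ht hs]
        · simp [f.eq_zero_of_notMem hs] }

theorem mul_apply (f g : TwistedCc α μ) (t : G) :
    (f * g) t = ∫ s, f s * α.aut s (g (s⁻¹ * t)) ∂μ := rfl

theorem continuous_twist (g : TwistedCc α μ) {Y : Type*} [TopologicalSpace Y] {a b : Y → G}
    (ha : Continuous a) (hb : Continuous b) : Continuous fun y => α.aut (a y) (g (b y)) :=
  α.continuous_act ha (g.continuous.comp hb)

theorem integrable_conv (f g : TwistedCc α μ) (t : G) :
    Integrable (fun s => f s * α.aut s (g (s⁻¹ * t))) μ :=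
  f.integrable_of_factor
    (f.continuous.mul (g.continuous_twist continuous_id (by fun_prop))) fun s hs => by simp [hs]

theorem mul_assoc_aux [μ.IsMulLeftInvariant] (f g h : TwistedCc α μ) :
    f * g * h = f * (g * h) := by
  ext t
  have step : ∀ r, f r * α.aut r ((g * h) (r⁻¹ * t)) =
      ∫ s, f r * (α.aut r (g (r⁻¹ * s)) * α.aut s (h (s⁻¹ * t))) ∂μ := by
    intro r
    let T : A →L[ℂ] A :=
      (ContinuousLinearMap.mul ℂ A (f r)).comp (α.aut r).toContinuousLinearEquiv.toContinuousLinearMap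
    have h1 : f r * α.aut r ((g * h) (r⁻¹ * t)) = T ((g * h) (r⁻¹ * t)) := rfl
    rw [h1, mul_apply, ← T.integral_comp_comm (integrable_conv g h _),
      ← integral_mul_left_eq_self
        (fun s => f r * (α.aut r (g (r⁻¹ * s)) * α.aut s (h (s⁻¹ * t)))) r]
    congr 1 with s
    simp only [T, ContinuousLinearMap.comp_apply, ContinuousLinearMap.mul_apply',
      ContinuousLinearEquiv.coe_coe, LinearIsometryEquiv.coe_toContinuousLinearEquiv, α.aut_mul,
      map_mul, LinearIsometryEquiv.coe_mul, Function.comp_apply, inv_mul_cancel_left, mul_inv_rev, mul_assoc]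
  calc (f * g * h) t
      = ∫ s, (∫ r, f r * (α.aut r (g (r⁻¹ * s)) * α.aut s (h (s⁻¹ * t))) ∂μ) ∂μ := by
        rw [mul_apply]
        congr 1 with s
        have := ((ContinuousLinearMap.mul ℂ A).flip (α.aut s (h (s⁻¹ * t)))).integral_comp_comm
          (integrable_conv f g s)
        simp only [ContinuousLinearMap.flip_apply, ContinuousLinearMap.mul_apply'] at this
        rw [mul_apply, ← this]
        simp only [mul_assoc]
    _ = ∫ r, (∫ s, f r * (α.aut r (g (r⁻¹ * s)) * α.aut s (h (s⁻¹ * t))) ∂μ) ∂μ := by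
        refine integral_integral_swap_of_hasCompactSupport
          (f := fun s r => f r * (α.aut r (g (r⁻¹ * s)) * α.aut s (h (s⁻¹ * t)))) ?_ ?_
        · simp only [Function.uncurry_def]
          exact (f.continuous.comp continuous_snd).mul
            ((g.continuous_twist continuous_snd (by fun_prop)).mul
              (h.continuous_twist continuous_fst (by fun_prop)))
        · refine HasCompactSupport.intro
            ((f.hasCompactSupport.isCompact.mul g.hasCompactSupport).prod f.hasCompactSupport) ?_
          rintro ⟨s, r⟩ hsr
          by_cases hr : r ∈ tsupport f
          · have hs : s ∉ tsupport f * tsupport g := fun hs => hsr ⟨hs, hr⟩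
            simp [conv_kernel_eq_zero f g hs hr]
          · simp [f.eq_zero_of_notMem hr]
    _ = (f * (g * h)) t := by
        rw [mul_apply]
        exact integral_congr_ae (Eventually.of_forall fun r => (step r).symm)

noncomputable instance [μ.IsMulLeftInvariant] : NonUnitalRing (TwistedCc α μ) where
  left_distrib f g h := by
    ext t
    simp only [add_apply, mul_apply, map_add, mul_add]
    exact integral_add (integrable_conv f g t) (integrable_conv f h t)
  right_distrib f g h := by
    ext t
    simp only [add_apply, mul_apply, add_mul]
    exact integral_add (integrable_conv f h t) (integrable_conv g h t)
  zero_mul f := by ext t; simp [mul_apply]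
  mul_zero f := by ext t; simp [mul_apply]
  mul_assoc := mul_assoc_aux

instance [μ.IsMulLeftInvariant] : IsScalarTower ℂ (TwistedCc α μ) (TwistedCc α μ) where
  smul_assoc c f g := by
    ext t
    simp only [smul_eq_mul, smul_apply, mul_apply, smul_mul_assoc, integral_smul]

instance [μ.IsMulLeftInvariant] : SMulCommClass ℂ (TwistedCc α μ) (TwistedCc α μ) where
  smul_comm c f g := by
    ext t
    simp only [smul_eq_mul, smul_apply, mul_apply, map_smul, mul_smul_comm, integral_smul]

end TwistedCc

/-- A nondegenerate contractive covariant representation `(π, v)` of `(G, A, α)` on the space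
`L^p(X, ν)`. It is `σ`-finite when `ν` is. -/
structure CovariantRep (p : ℝ≥0∞) [Fact (1 ≤ p)] (α : IsometricAction G A)
    {X : Type*} [MeasurableSpace X] (ν : Measure X) where
  π : A →ₙₐ[ℂ] (Lp ℂ p ν →L[ℂ] Lp ℂ p ν)
  contractive : IsContractiveRep π
  nondegenerate : IsNondegenerateRep π
  v : G →* (Lp ℂ p ν ≃ₗᵢ[ℂ] Lp ℂ p ν)
  continuous_v : ∀ ξ, Continuous fun t => v t ξ
  covariant : ∀ (t : G) (a : A) (ξ : Lp ℂ p ν), v t (π a (v t⁻¹ ξ)) = π (α.aut t a) ξ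

namespace CovariantRep

variable {p : ℝ≥0∞} [Fact (1 ≤ p)] {α : IsometricAction G A} {μ : Measure G}
  {X : Type*} [MeasurableSpace X] {ν : Measure X}

/-- `π` as a continuous linear map. -/
noncomputable def πL (R : CovariantRep p α ν) : A →L[ℂ] (Lp ℂ p ν →L[ℂ] Lp ℂ p ν) :=
  LinearMap.mkContinuous (R.π : A →ₗ[ℂ] (Lp ℂ p ν →L[ℂ] Lp ℂ p ν)) 1
    fun a => by simpa using R.contractive a

@[simp] theorem πL_apply (R : CovariantRep p α ν) (a : A) : R.πL a = R.π a := rfl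

theorem continuous_integrand (R : CovariantRep p α ν) {Y : Type*} [TopologicalSpace Y] {a : Y → A}
    {s : Y → G} {ξ : Y → Lp ℂ p ν} (ha : Continuous a) (hs : Continuous s) (hξ : Continuous ξ) :
    Continuous fun y => R.π (a y) (R.v (s y) (ξ y)) :=
  (R.πL.continuous.comp ha).clm_apply
    ((continuous_uncurry_isometricRep R.v R.continuous_v).comp (hs.prodMk hξ))

theorem norm_integrand_le (R : CovariantRep p α ν) (a : A) (t : G) (ξ : Lp ℂ p ν) :
    ‖R.π a (R.v t ξ)‖ ≤ ‖a‖ * ‖ξ‖ := by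
  calc ‖R.π a (R.v t ξ)‖ ≤ ‖R.π a‖ * ‖R.v t ξ‖ := ContinuousLinearMap.le_opNorm _ _
    _ ≤ ‖a‖ * ‖ξ‖ := by
      rw [LinearIsometryEquiv.norm_map]
      exact mul_le_mul_of_nonneg_right (R.contractive a) (norm_nonneg _)

theorem π_v_mul (R : CovariantRep p α ν) (a b : A) (s t : G) (ξ : Lp ℂ p ν) :
    R.π (a * α.aut s b) (R.v (s * t) ξ) = R.π a (R.v s (R.π b (R.v t ξ))) := by
  have h : R.v s⁻¹ (R.v (s * t) ξ) = R.v t ξ := by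
    rw [← Function.comp_apply (f := R.v s⁻¹), ← LinearIsometryEquiv.coe_mul, ← map_mul,
      inv_mul_cancel_left]
  rw [map_mul, mul_apply_eq_comp, ← R.covariant s b, h]

variable [IsFiniteMeasureOnCompacts μ]

theorem integrable_integrand (R : CovariantRep p α ν) (f : TwistedCc α μ) (ξ : Lp ℂ p ν) :
    Integrable (fun t => R.π (f t) (R.v t ξ)) μ :=
  f.integrable_of_factor (R.continuous_integrand f.continuous continuous_id continuous_const)
    fun t ht => by simp [ht]

/-- The operator `(π ⋊ v)(f)`, given by `(π ⋊ v)(f)ξ = ∫ π(f(t)) v_t(ξ) dμ(t)`. -/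
noncomputable def integrated (R : CovariantRep p α ν) (f : TwistedCc α μ) :
    Lp ℂ p ν →L[ℂ] Lp ℂ p ν :=
  LinearMap.mkContinuous
    { toFun := fun ξ => ∫ t, R.π (f t) (R.v t ξ) ∂μ
      map_add' := fun ξ η => by
        simp only [map_add]
        exact integral_add (R.integrable_integrand f ξ) (R.integrable_integrand f η)
      map_smul' := fun c ξ => by
        simp only [map_smul, integral_smul, RingHom.id_apply] }
    (∫ t, ‖f t‖ ∂μ)
    (fun ξ => by
      rw [← integral_mul_const]
      refine norm_integral_le_of_norm_le ?_
        (Eventually.of_forall fun t => R.norm_integrand_le (f t) t ξ)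
      exact (f.integrable_of_factor f.continuous.norm fun t ht => by simp [ht]).mul_const _)

theorem integrated_apply (R : CovariantRep p α ν) (f : TwistedCc α μ) (ξ : Lp ℂ p ν) :
    R.integrated f ξ = ∫ t, R.π (f t) (R.v t ξ) ∂μ := rfl

theorem norm_integrated_le (R : CovariantRep p α ν) (f : TwistedCc α μ) :
    ‖R.integrated f‖ ≤ ∫ t, ‖f t‖ ∂μ :=
  LinearMap.mkContinuous_norm_le _ (integral_nonneg fun _ => norm_nonneg _) _

theorem integrated_add (R : CovariantRep p α ν) (f g : TwistedCc α μ) :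
    R.integrated (f + g) = R.integrated f + R.integrated g := by
  ext1 ξ
  simp only [_root_.add_apply, integrated_apply, TwistedCc.add_apply, map_add]
  exact integral_add (R.integrable_integrand f ξ) (R.integrable_integrand g ξ)

theorem integrated_smul (R : CovariantRep p α ν) (c : ℂ) (f : TwistedCc α μ) :
    R.integrated (c • f) = c • R.integrated f := by
  ext1 ξ
  simp only [_root_.smul_apply, integrated_apply, TwistedCc.smul_apply, map_smul,
    integral_smul]

theorem integrated_mul [μ.IsMulLeftInvariant] (R : CovariantRep p α ν) (f g : TwistedCc α μ) :
    R.integrated (f * g) = R.integrated f * R.integrated g := by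
  ext1 ξ
  calc R.integrated (f * g) ξ
      = ∫ t, (∫ s, R.π (f s * α.aut s (g (s⁻¹ * t))) (R.v t ξ) ∂μ) ∂μ := by
        rw [integrated_apply]
        congr 1 with t : 1
        exact ((R.πL.flip (R.v t ξ)).integral_comp_comm (TwistedCc.integrable_conv f g t)).symm
    _ = ∫ s, (∫ t, R.π (f s * α.aut s (g (s⁻¹ * t))) (R.v t ξ) ∂μ) ∂μ := by
        refine integral_integral_swap_of_hasCompactSupport
          (f := fun t s => R.π (f s * α.aut s (g (s⁻¹ * t))) (R.v t ξ)) ?_ ?_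
        · simp only [Function.uncurry_def]
          exact R.continuous_integrand ((f.continuous.comp continuous_snd).mul
            (g.continuous_twist continuous_snd (by fun_prop))) continuous_fst continuous_const
        · refine HasCompactSupport.intro
            ((f.hasCompactSupport.isCompact.mul g.hasCompactSupport).prod f.hasCompactSupport) ?_
          rintro ⟨t, s⟩ hts
          by_cases hs : s ∈ tsupport f
          · have ht : t ∉ tsupport f * tsupport g := fun ht => hts ⟨ht, hs⟩
            simp [TwistedCc.conv_kernel_eq_zero f g ht hs]
          · simp [f.eq_zero_of_notMem hs]
    _ = ∫ s, R.π (f s) (R.v s (R.integrated g ξ)) ∂μ := by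
        congr 1 with s : 1
        let T : Lp ℂ p ν →L[ℂ] Lp ℂ p ν :=
          (R.π (f s)).comp (R.v s).toContinuousLinearEquiv.toContinuousLinearMap
        have h1 : R.π (f s) (R.v s (R.integrated g ξ)) = T (R.integrated g ξ) := rfl
        rw [h1, integrated_apply, ← T.integral_comp_comm (R.integrable_integrand g ξ),
          ← integral_mul_left_eq_self
            (fun t => R.π (f s * α.aut s (g (s⁻¹ * t))) (R.v t ξ)) s]
        congr 1 with t : 1
        rw [inv_mul_cancel_left, π_v_mul]
        rfl
    _ = (R.integrated f * R.integrated g) ξ := rfl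

end CovariantRep

/-- The values `‖(π ⋊ v)(f)‖`, where `(π, v)` ranges over all nondegenerate `σ`-finite contractive
covariant representations of `(G, A, α)` on `L^p` spaces. -/
def repNorms (p : ℝ≥0∞) [Fact (1 ≤ p)] {α : IsometricAction G A} {μ : Measure G}
    [IsFiniteMeasureOnCompacts μ] (f : TwistedCc α μ) : Set ℝ :=
  {r | ∃ (X : Type w) (_ : MeasurableSpace X) (ν : Measure X) (_ : SigmaFinite ν)
    (R : CovariantRep p α ν), r = ‖R.integrated f‖}

section Norm

variable {p : ℝ≥0∞} [Fact (1 ≤ p)] {α : IsometricAction G A} {μ : Measure G}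
  [IsFiniteMeasureOnCompacts μ]

/-- The norm `‖f‖ = sup ‖(π ⋊ v)(f)‖` on `C_c(G, A, α)`. -/
noncomputable def fpNorm (p : ℝ≥0∞) [Fact (1 ≤ p)] (f : TwistedCc α μ) : ℝ :=
  sSup (repNorms.{w} p f)

theorem norm_integrated_le_fpNorm {X : Type w} [MeasurableSpace X] {ν : Measure X}
    [hν : SigmaFinite ν] (R : CovariantRep p α ν) (f : TwistedCc α μ) :
    ‖R.integrated f‖ ≤ fpNorm.{w} p f := by
  refine le_csSup ⟨∫ t, ‖f t‖ ∂μ, ?_⟩ ⟨X, _, ν, hν, R, rfl⟩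
  rintro r ⟨_, _, _, _, R, rfl⟩
  exact R.norm_integrated_le f

theorem fpNorm_nonneg (f : TwistedCc α μ) : 0 ≤ fpNorm.{w} p f := by
  refine Real.sSup_nonneg ?_
  rintro r ⟨_, _, _, _, R, rfl⟩
  exact norm_nonneg _

theorem fpNorm_le (f : TwistedCc α μ) {c : ℝ} (hc : 0 ≤ c)
    (h : ∀ (X : Type w) [MeasurableSpace X] (ν : Measure X) [SigmaFinite ν]
      (R : CovariantRep p α ν), ‖R.integrated f‖ ≤ c) : fpNorm.{w} p f ≤ c := by
  refine Real.sSup_le ?_ hc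
  rintro r ⟨X, _, ν, _, R, rfl⟩
  exact h X ν R

theorem fpNorm_add_le (f g : TwistedCc α μ) :
    fpNorm.{w} p (f + g) ≤ fpNorm.{w} p f + fpNorm.{w} p g := by
  refine fpNorm_le _ (add_nonneg (fpNorm_nonneg f) (fpNorm_nonneg g)) fun X _ ν _ R => ?_
  rw [R.integrated_add]
  exact (norm_add_le _ _).trans
    (add_le_add (norm_integrated_le_fpNorm R f) (norm_integrated_le_fpNorm R g))

theorem fpNorm_smul_le (c : ℂ) (f : TwistedCc α μ) :
    fpNorm.{w} p (c • f) ≤ ‖c‖ * fpNorm.{w} p f := by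
  refine fpNorm_le _ (mul_nonneg (norm_nonneg c) (fpNorm_nonneg f)) fun X _ ν _ R => ?_
  rw [R.integrated_smul, norm_smul]
  exact mul_le_mul_of_nonneg_left (norm_integrated_le_fpNorm R f) (norm_nonneg c)

theorem fpNorm_mul_le [μ.IsMulLeftInvariant] (f g : TwistedCc α μ) :
    fpNorm.{w} p (f * g) ≤ fpNorm.{w} p f * fpNorm.{w} p g := by
  refine fpNorm_le _ (mul_nonneg (fpNorm_nonneg f) (fpNorm_nonneg g)) fun X _ ν _ R => ?_
  rw [R.integrated_mul]
  exact (norm_mul_le _ _).trans (mul_le_mul (norm_integrated_le_fpNorm R f)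
    (norm_integrated_le_fpNorm R g) (norm_nonneg _) (fpNorm_nonneg f))

theorem fpNorm_neg (f : TwistedCc α μ) : fpNorm.{w} p (-f) = fpNorm.{w} p f := by
  have h : ∀ g : TwistedCc α μ, fpNorm.{w} p (-g) ≤ fpNorm.{w} p g := fun g => by
    simpa using fpNorm_smul_le (-1) g
  exact le_antisymm (h f) (by simpa using h (-f))

theorem fpNorm_zero : fpNorm.{w} p (0 : TwistedCc α μ) = 0 :=
  le_antisymm (by simpa using fpNorm_smul_le.{w} (p := p) 0 (0 : TwistedCc α μ)) (fpNorm_nonneg _)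

/-- `fpNorm` as a seminorm on the additive group `C_c(G, A, α)`. -/
noncomputable def fpGroupSeminorm (p : ℝ≥0∞) [Fact (1 ≤ p)] (α : IsometricAction G A)
    (μ : Measure G) [IsFiniteMeasureOnCompacts μ] : AddGroupSeminorm (TwistedCc α μ) where
  toFun := fpNorm.{w} p
  map_zero' := fpNorm_zero
  add_le' := fpNorm_add_le
  neg' := fpNorm_neg

/-- `C_c(G, A, α)` as a seminormed algebra under the norm `fpNorm`. -/
noncomputable abbrev fpSeminormedRing (p : ℝ≥0∞) [Fact (1 ≤ p)] (α : IsometricAction G A)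
    (μ : Measure G) [IsFiniteMeasureOnCompacts μ] [μ.IsMulLeftInvariant] :
    NonUnitalSeminormedRing (TwistedCc α μ) where
  toNonUnitalRing := inferInstance
  norm := fpNorm.{w} p
  toPseudoMetricSpace :=
    (fpGroupSeminorm.{w} p α μ).toSeminormedAddCommGroup.toPseudoMetricSpace
  dist_eq := (fpGroupSeminorm.{w} p α μ).toSeminormedAddCommGroup.dist_eq
  norm_mul_le := fpNorm_mul_le

noncomputable abbrev fpNormedSpace (p : ℝ≥0∞) [Fact (1 ≤ p)] (α : IsometricAction G A)
    (μ : Measure G) [IsFiniteMeasureOnCompacts μ] [μ.IsMulLeftInvariant] :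
    letI := fpSeminormedRing.{w} p α μ
    NormedSpace ℂ (TwistedCc α μ) :=
  letI := fpSeminormedRing.{w} p α μ
  { toModule := inferInstance
    norm_smul_le := fpNorm_smul_le }

end Norm

/-- The full `L^p` operator crossed product `F^p(G, A, α)`: the completion of `C_c(G, A, α)` in the
norm `fpNorm`. -/
def FpCrossedProduct (p : ℝ≥0∞) [Fact (1 ≤ p)] (α : IsometricAction G A) (μ : Measure G)
    [IsFiniteMeasureOnCompacts μ] [μ.IsMulLeftInvariant] : Type (max u v) :=
  letI := fpSeminormedRing.{w} p α μ
  UniformSpace.Completion (TwistedCc α μ)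

section FpCrossedProduct

variable {p : ℝ≥0∞} [Fact (1 ≤ p)] {α : IsometricAction G A} {μ : Measure G}
  [IsFiniteMeasureOnCompacts μ] [μ.IsMulLeftInvariant]

noncomputable instance : NonUnitalNormedRing (FpCrossedProduct.{w} p α μ) :=
  @NonUnitalCompletion.instRing (TwistedCc α μ) (fpSeminormedRing.{w} p α μ)

noncomputable instance : NormedSpace ℂ (FpCrossedProduct.{w} p α μ) :=
  @NonUnitalCompletion.instSpace (TwistedCc α μ) (fpSeminormedRing.{w} p α μ)
    (fpNormedSpace.{w} p α μ)

instance : IsScalarTower ℂ (FpCrossedProduct.{w} p α μ) (FpCrossedProduct.{w} p α μ) := by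
  let := fpSeminormedRing.{w} p α μ
  let := fpNormedSpace.{w} p α μ
  have h : IsScalarTower ℂ (UniformSpace.Completion (TwistedCc α μ))
    (UniformSpace.Completion (TwistedCc α μ)) := inferInstance
  exact h

instance : SMulCommClass ℂ (FpCrossedProduct.{w} p α μ) (FpCrossedProduct.{w} p α μ) := by
  let := fpSeminormedRing.{w} p α μ
  let := fpNormedSpace.{w} p α μ
  have h : SMulCommClass ℂ (UniformSpace.Completion (TwistedCc α μ))
    (UniformSpace.Completion (TwistedCc α μ)) := inferInstance
  exact h

instance : CompleteSpace (FpCrossedProduct.{w} p α μ) := by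
  let := fpSeminormedRing.{w} p α μ
  have h : CompleteSpace (UniformSpace.Completion (TwistedCc α μ)) := inferInstance
  exact h

namespace FpCrossedProduct

/-- The canonical homomorphism `C_c(G, A, α) → F^p(G, A, α)`. -/
noncomputable def ofCc (p : ℝ≥0∞) [Fact (1 ≤ p)] (α : IsometricAction G A) (μ : Measure G)
    [IsFiniteMeasureOnCompacts μ] [μ.IsMulLeftInvariant] :
    TwistedCc α μ →ₙₐ[ℂ] FpCrossedProduct.{w} p α μ :=
  letI := fpSeminormedRing.{w} p α μ
  letI := fpNormedSpace.{w} p α μ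
  NonUnitalCompletion.coeHom

theorem norm_ofCc (f : TwistedCc α μ) : ‖ofCc.{w} p α μ f‖ = fpNorm.{w} p f :=
  letI := fpSeminormedRing.{w} p α μ
  UniformSpace.Completion.norm_coe f

theorem denseRange_ofCc : DenseRange (ofCc.{w} p α μ) :=
  letI := fpSeminormedRing.{w} p α μ
  UniformSpace.Completion.denseRange_coe

end FpCrossedProduct

namespace CovariantRep

variable {X : Type w} [MeasurableSpace X] {ν : Measure X}

/-- The integrated form `π ⋊ v` as a homomorphism on `C_c(G, A, α)`. -/
noncomputable def integratedCc (R : CovariantRep p α ν) :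
    TwistedCc α μ →ₙₐ[ℂ] (Lp ℂ p ν →L[ℂ] Lp ℂ p ν) where
  toFun := R.integrated
  map_smul' := R.integrated_smul
  map_zero' := by simpa using R.integrated_smul 0 (0 : TwistedCc α μ)
  map_add' := R.integrated_add
  map_mul' := R.integrated_mul

/-- The integrated form `π ⋊ v`, extended by continuity to `F^p(G, A, α)`. -/
noncomputable def integratedForm [SigmaFinite ν] (R : CovariantRep p α ν) (μ : Measure G)
    [IsFiniteMeasureOnCompacts μ] [μ.IsMulLeftInvariant] :
    FpCrossedProduct.{w} p α μ →ₙₐ[ℂ] (Lp ℂ p ν →L[ℂ] Lp ℂ p ν) :=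
  letI := fpSeminormedRing.{w} p α μ
  letI := fpNormedSpace.{w} p α μ
  NonUnitalCompletion.extendHom R.integratedCc (norm_integrated_le_fpNorm R)

theorem integratedForm_ofCc [SigmaFinite ν] (R : CovariantRep p α ν) (f : TwistedCc α μ) :
    R.integratedForm μ (FpCrossedProduct.ofCc.{w} p α μ f) = R.integrated f := by
  let := fpSeminormedRing.{w} p α μ
  let := fpNormedSpace.{w} p α μ
  have h := NonUnitalCompletion.extendHom_coe R.integratedCc (norm_integrated_le_fpNorm R) f
  exact h

theorem continuous_integratedForm [SigmaFinite ν] (R : CovariantRep p α ν) :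
    Continuous (R.integratedForm μ) := by
  let := fpSeminormedRing.{w} p α μ
  let := fpNormedSpace.{w} p α μ
  have hT : ∀ f : TwistedCc α μ, ‖R.integratedCc f‖ ≤ ‖f‖ := norm_integrated_le_fpNorm R
  have h := NonUnitalCompletion.continuous_extendHom (R := TwistedCc α μ)
    (T := R.integratedCc) hT
  exact h

theorem norm_integratedForm_le [SigmaFinite ν] (R : CovariantRep p α ν)
    (x : FpCrossedProduct.{w} p α μ) : ‖R.integratedForm μ x‖ ≤ ‖x‖ := by
  refine FpCrossedProduct.denseRange_ofCc.induction_on x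
    (isClosed_le R.continuous_integratedForm.norm continuous_norm) fun f => ?_
  rw [integratedForm_ofCc, FpCrossedProduct.norm_ofCc]
  exact norm_integrated_le_fpNorm R f

end CovariantRep

end FpCrossedProduct

end CrossedProduct

/-! Both `A` and `G` act on $C_c(G,A,\alpha)$ from the left, by $(a\cdot f)(s)=af(s)$ and $(t\cdot
f)(s)=\alpha_t(f(t^{-1}s))$. These actions commute with right convolution. An integrated form
$\pi\rtimes v$ turns them into composition with $\pi(a)$ and $v_t$, so in the crossed product norm
they are bounded by $\|a\|$ and $1$. The representation $L$ must therefore come from the pair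
determined by $\pi(a)L(f)\xi=L(a\cdot f)\xi$ and $v_tL(f)\xi=L(t\cdot f)\xi$, since the vectors
$L(f)\xi$ span a dense subspace.

The issue is whether these formulas define bounded operators (`norm_combination_le`). Let $T$ be a
left multiplier with bound $C$, and let $e$ run through a contractive left approximate identity in
$C_c(G,A,\alpha)$ (`exists_left_approx_identity`). Then $T(e)*f=T(e*f)\to T(f)$, so $\sum
c_iL(Tf_i)\xi_i$ is the limit of $L(Te)$ applied to $\sum c_iL(f_i)\xi_i$. Since $\|L(Te)\|\le C$,
the map is well defined and has norm at most $C$. Covariance and multiplicativity pass from the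
multipliers to the operators.

To recover $L$, write convolution as a Bochner integral in the crossed product, $f*g=\int
f(t)\cdot(t\cdot g)\,d\mu(t)$ (`integral_ofCc_leftMul_translate`). Applying $L$ gives
$L(f)L(g)\xi=\int\pi(f(t))v_tL(g)\xi\,d\mu(t)$, which is $(\pi\rtimes v)(f)$ on a total set of
vectors. -/

section LeftMultipliers

variable {G : Type u} {A : Type v} [Group G] [TopologicalSpace G] [IsTopologicalGroup G]
  [LocallyCompactSpace G] [MeasurableSpace G] [BorelSpace G]
  [NonUnitalNormedRing A] [NormedSpace ℂ A] [IsScalarTower ℂ A A] [SMulCommClass ℂ A A]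
  [CompleteSpace A] {α : IsometricAction G A} {μ : Measure G}

/-! ### The left actions of the coefficient algebra and the group on compactly supported functions.
-/

namespace IsometricAction

theorem aut_mul_apply (α : IsometricAction G A) (s t : G) (a : A) :
    α.aut (s * t) a = α.aut s (α.aut t a) := by
  rw [map_mul]; rfl

end IsometricAction

namespace TwistedCc

/-- Pointwise left multiplication by an element of the coefficient algebra. -/
noncomputable def leftMul (a : A) : TwistedCc α μ →ₗ[ℂ] TwistedCc α μ where
  toFun f :=
    { toFun := fun t => a * f t
      continuous_toFun := continuous_const.mul f.continuous
      hasCompactSupport' := HasCompactSupport.intro f.hasCompactSupport fun t ht => by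
        simp [f.eq_zero_of_notMem ht] }
  map_add' f g := by ext t; exact mul_add a (f t) (g t)
  map_smul' c f := by ext t; exact mul_smul_comm c a (f t)

/-- The twisted left translation `(t · f)(s) = α_t(f(t⁻¹s))`. -/
noncomputable def translate (t : G) : TwistedCc α μ →ₗ[ℂ] TwistedCc α μ where
  toFun f :=
    { toFun := fun s => α.aut t (f (t⁻¹ * s))
      continuous_toFun :=
        (α.aut t).continuous.comp (f.continuous.comp (continuous_const.mul continuous_id))
      hasCompactSupport' := by
        refine HasCompactSupport.intro (f.hasCompactSupport.isCompact.smul t) fun s hs => ?_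
        rw [f.eq_zero_of_notMem fun h => hs ⟨_, h, by simp⟩, map_zero] }
  map_add' f g := by ext s; exact map_add (α.aut t) (f (t⁻¹ * s)) (g (t⁻¹ * s))
  map_smul' c f := by ext s; exact map_smul (α.aut t) c (f (t⁻¹ * s))

/-- The function `t ↦ φ(t) a`. -/
noncomputable def scalarMul (φ : C_c(G, ℝ)) (a : A) : TwistedCc α μ :=
  show C_c(G, A) from
  { toFun := fun t => (φ t : ℂ) • a
    continuous_toFun := by
      have := φ.continuous
      fun_prop
    hasCompactSupport' := HasCompactSupport.intro φ.hasCompactSupport fun t ht => by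
      simp [image_eq_zero_of_notMem_tsupport ht] }

@[simp] theorem leftMul_apply (a : A) (f : TwistedCc α μ) (t : G) : leftMul a f t = a * f t := rfl

@[simp] theorem translate_apply (t : G) (f : TwistedCc α μ) (s : G) :
    translate t f s = α.aut t (f (t⁻¹ * s)) := rfl

@[simp] theorem scalarMul_apply (φ : C_c(G, ℝ)) (a : A) (t : G) :
    (scalarMul φ a : TwistedCc α μ) t = (φ t : ℂ) • a := rfl

@[simp] theorem sub_apply (f g : TwistedCc α μ) (t : G) : (f - g) t = f t - g t := rfl

theorem translate_one (f : TwistedCc α μ) : translate 1 f = f := by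
  ext s; simp

theorem translate_mul (s t : G) (f : TwistedCc α μ) :
    translate (s * t) f = translate s (translate t f) := by
  ext r
  simp only [translate_apply, α.aut_mul_apply, mul_inv_rev, mul_assoc]

theorem leftMul_smul (c : ℂ) (a : A) (f : TwistedCc α μ) :
    leftMul (c • a) f = c • leftMul a f := by
  ext t; exact smul_mul_assoc c a (f t)

theorem leftMul_zero (f : TwistedCc α μ) : leftMul (0 : A) f = 0 := by
  ext t; simp

theorem leftMul_add (a b : A) (f : TwistedCc α μ) :
    leftMul (a + b) f = leftMul a f + leftMul b f := by
  ext t; exact add_mul a b (f t)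

theorem leftMul_mul (a b : A) (f : TwistedCc α μ) :
    leftMul (a * b) f = leftMul a (leftMul b f) := by
  ext t; exact mul_assoc a b (f t)

/-- The source of covariance: this identity between multipliers becomes the covariance relation of
the constructed pair. -/
theorem translate_leftMul_translate_inv (t : G) (a : A) (f : TwistedCc α μ) :
    translate t (leftMul a (translate t⁻¹ f)) = leftMul (α.aut t a) f := by
  ext s
  simp only [translate_apply, leftMul_apply, α.aut_mul, ← α.aut_mul_apply]
  simp

variable [IsFiniteMeasureOnCompacts μ]

theorem leftMul_conv (a : A) (f g : TwistedCc α μ) :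
    leftMul a (f * g) = leftMul a f * g := by
  ext t
  have := (ContinuousLinearMap.mul ℂ A a).integral_comp_comm (integrable_conv f g t)
  simp only [ContinuousLinearMap.mul_apply'] at this
  simp only [leftMul_apply, mul_apply, ← this, mul_assoc]

/-- Substitute $s\mapsto ts$ in the convolution integral; left invariance of `μ` is what makes this
possible. -/
theorem translate_conv [μ.IsMulLeftInvariant] (t : G) (f g : TwistedCc α μ) :
    translate t (f * g) = translate t f * g := by
  ext r
  have := (α.aut t).toContinuousLinearEquiv.toContinuousLinearMap.integral_comp_comm
    (integrable_conv f g (t⁻¹ * r))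
  simp only [ContinuousLinearEquiv.coe_coe, LinearIsometryEquiv.coe_toContinuousLinearEquiv] at this
  rw [translate_apply, mul_apply, ← this, mul_apply,
    ← integral_mul_left_eq_self (fun s => translate t f s * α.aut s (g (s⁻¹ * r))) t]
  congr 1 with s
  simp only [translate_apply, inv_mul_cancel_left, α.aut_mul, α.aut_mul_apply, mul_inv_rev,
    mul_assoc]

theorem integrable_norm (f : TwistedCc α μ) : Integrable (fun t => ‖f t‖) μ :=
  f.integrable_of_factor f.continuous.norm fun t ht => by simp [ht]

end TwistedCc

/-! ### Integrated forms turn the two actions into $\pi(a)$ and $v_t$. -/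

namespace CovariantRep

variable {p : ℝ≥0∞} [Fact (1 ≤ p)] [IsFiniteMeasureOnCompacts μ]
  {X : Type*} [MeasurableSpace X] {ν : Measure X}

theorem integrated_leftMul (R : CovariantRep p α ν) (a : A) (f : TwistedCc α μ) :
    R.integrated (f.leftMul a) = R.π a * R.integrated f := by
  ext1 ξ
  rw [mul_apply_eq_comp, integrated_apply, integrated_apply,
    ← (R.π a).integral_comp_comm (R.integrable_integrand f ξ)]
  simp only [TwistedCc.leftMul_apply, map_mul, mul_apply_eq_comp]

theorem integrated_translate [μ.IsMulLeftInvariant] (R : CovariantRep p α ν) (t : G)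
    (f : TwistedCc α μ) (ξ : Lp ℂ p ν) :
    R.integrated (f.translate t) ξ = R.v t (R.integrated f ξ) := by
  have h := (R.v t).toContinuousLinearEquiv.toContinuousLinearMap.integral_comp_comm
    (R.integrable_integrand f ξ)
  simp only [ContinuousLinearEquiv.coe_coe, LinearIsometryEquiv.coe_toContinuousLinearEquiv] at h
  rw [integrated_apply, integrated_apply, ← h,
    ← integral_mul_left_eq_self (fun s => R.π (f.translate t s) (R.v s ξ)) t]
  congr 1 with s : 1
  have h1 : R.v t⁻¹ (R.v (t * s) ξ) = R.v s ξ := by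
    rw [← Function.comp_apply (f := R.v t⁻¹), ← LinearIsometryEquiv.coe_mul, ← map_mul,
      inv_mul_cancel_left]
  rw [TwistedCc.translate_apply, inv_mul_cancel_left, ← R.covariant, h1]

end CovariantRep

/-! ### Norm estimates and vector-valued integrals in the crossed product. -/

namespace FpCrossedProduct

variable {p : ℝ≥0∞} [Fact (1 ≤ p)] [IsFiniteMeasureOnCompacts μ] [μ.IsMulLeftInvariant]

/-- Every integrated form obeys this $L^1$ bound, hence so does the supremum. It lets convergence in
the crossed product be checked in $L^1$. -/
theorem norm_ofCc_le_integral (f : TwistedCc α μ) : ‖ofCc.{w} p α μ f‖ ≤ ∫ t, ‖f t‖ ∂μ := by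
  rw [norm_ofCc]
  exact fpNorm_le f (integral_nonneg fun _ => norm_nonneg _) fun X _ ν _ R =>
    R.norm_integrated_le f

theorem norm_ofCc_leftMul_le (a : A) (f : TwistedCc α μ) :
    ‖ofCc.{w} p α μ (f.leftMul a)‖ ≤ ‖a‖ * ‖ofCc.{w} p α μ f‖ := by
  rw [norm_ofCc, norm_ofCc]
  refine fpNorm_le _ (mul_nonneg (norm_nonneg a) (fpNorm_nonneg f)) fun X _ ν _ R => ?_
  rw [R.integrated_leftMul]
  exact (norm_mul_le _ _).trans (mul_le_mul (R.contractive a) (norm_integrated_le_fpNorm R f)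
    (norm_nonneg _) (norm_nonneg _))

theorem norm_ofCc_translate_le (t : G) (f : TwistedCc α μ) :
    ‖ofCc.{w} p α μ (f.translate t)‖ ≤ ‖ofCc.{w} p α μ f‖ := by
  rw [norm_ofCc, norm_ofCc]
  refine fpNorm_le _ (fpNorm_nonneg f) fun X _ ν _ R => ?_
  refine ContinuousLinearMap.opNorm_le_bound _ (fpNorm_nonneg f) fun ξ => ?_
  rw [R.integrated_translate, LinearIsometryEquiv.norm_map]
  exact (R.integrated f).le_of_opNorm_le (norm_integrated_le_fpNorm R f) ξ

/-- The integrated forms of the covariant representations separate the points of the crossed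
product. -/
theorem ext_integratedForm {y z : FpCrossedProduct.{w} p α μ}
    (h : ∀ (X : Type w) [MeasurableSpace X] (ν : Measure X) [SigmaFinite ν]
      (R : CovariantRep p α ν), R.integratedForm μ y = R.integratedForm μ z) : y = z := by
  rw [← sub_eq_zero, ← norm_le_zero_iff]
  refine le_of_forall_pos_le_add fun ε hε => ?_
  -- The norm is a supremum over representations by definition only on $C_c$, so replace $y-z$ by a
  -- nearby `f`. Each integrated form kills $y-z$, so on `f` it sees only the approximation error.
  obtain ⟨f, hf⟩ := Metric.denseRange_iff.1 denseRange_ofCc.{w} (y - z) (ε / 2) (half_pos hε)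
  rw [dist_eq_norm] at hf
  have h1 : ‖ofCc.{w} p α μ f‖ ≤ ε / 2 := by
    rw [norm_ofCc]
    refine fpNorm_le f (half_pos hε).le fun X _ ν _ R => ?_
    have h2 : R.integrated f = -R.integratedForm μ (y - z - ofCc.{w} p α μ f) := by
      rw [map_sub, map_sub, h X ν R, sub_self, zero_sub, neg_neg, R.integratedForm_ofCc]
    rw [h2, norm_neg]
    exact (R.norm_integratedForm_le _).trans hf.le
  calc ‖y - z‖ = ‖(y - z - ofCc.{w} p α μ f) + ofCc.{w} p α μ f‖ := by rw [sub_add_cancel]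
    _ ≤ ε / 2 + ε / 2 := (norm_add_le _ _).trans (add_le_add hf.le h1)
    _ = 0 + ε := by ring

/-- Joint continuity and locally uniform compact support give continuity in the $L^1$ norm, which
dominates. -/
theorem continuous_ofCc {Y : Type*} [TopologicalSpace Y] {H : Y → TwistedCc α μ}
    (hH : Continuous fun q : Y × G => H q.1 q.2)
    (hK : ∀ y₀, ∃ K, IsCompact K ∧ ∀ᶠ y in 𝓝 y₀, ∀ t ∉ K, H y t = 0) :
    Continuous fun y => ofCc.{w} p α μ (H y) := by
  rw [continuous_iff_continuousAt]
  intro y₀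
  obtain ⟨K, hKc, hK⟩ := hK y₀
  have h1 : ContinuousOn (fun y => ∫ t, ‖H y t - H y₀ t‖ ∂μ) {y | ∀ t ∉ K, H y t = 0} := by
    refine continuousOn_integral_of_compact_support hKc (Continuous.continuousOn ?_) ?_
    · exact (hH.sub ((H y₀).continuous.comp continuous_snd)).norm
    · intro y t hy ht
      simp [hy t ht, hK.self_of_nhds t ht]
  have h2 : Tendsto (fun y => ∫ t, ‖H y t - H y₀ t‖ ∂μ) (𝓝 y₀) (𝓝 0) := by
    simpa using (h1.continuousAt hK).tendsto
  rw [ContinuousAt, tendsto_iff_norm_sub_tendsto_zero]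
  refine squeeze_zero (fun _ => norm_nonneg _) (fun y => ?_) h2
  rw [← map_sub]
  exact norm_ofCc_le_integral _

theorem continuous_ofCc_leftMul_translate {a : G → A} (ha : Continuous a) (g : TwistedCc α μ) :
    Continuous fun t => ofCc.{w} p α μ ((g.translate t).leftMul (a t)) := by
  refine continuous_ofCc ?_ fun t₀ => ?_
  · exact (ha.comp continuous_fst).mul (g.continuous_twist continuous_fst (by fun_prop))
  · obtain ⟨K, hK, hKt⟩ := exists_compact_mem_nhds t₀
    refine ⟨K * tsupport g, hK.mul g.hasCompactSupport, ?_⟩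
    filter_upwards [hKt] with t ht s hs
    have : g (t⁻¹ * s) = 0 := g.eq_zero_of_notMem fun h => hs ⟨t, ht, _, h, by simp⟩
    simp [this]

theorem continuous_ofCc_translate (g : TwistedCc α μ) :
    Continuous fun t => ofCc.{w} p α μ (g.translate t) := by
  refine continuous_ofCc ?_ fun t₀ => ?_
  · exact g.continuous_twist continuous_fst (by fun_prop)
  · obtain ⟨K, hK, hKt⟩ := exists_compact_mem_nhds t₀
    refine ⟨K * tsupport g, hK.mul g.hasCompactSupport, ?_⟩
    filter_upwards [hKt] with t ht s hs
    have : g (t⁻¹ * s) = 0 := g.eq_zero_of_notMem fun h => hs ⟨t, ht, _, h, by simp⟩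
    simp [this]

theorem integrable_ofCc_leftMul_translate (f g : TwistedCc α μ) :
    Integrable (fun t => ofCc.{w} p α μ ((g.translate t).leftMul (f t))) μ :=
  f.integrable_of_factor (continuous_ofCc_leftMul_translate f.continuous g) fun t ht => by
    rw [ht, TwistedCc.leftMul_zero, map_zero]

/-- Twisted convolution as a vector-valued integral in the crossed product. -/
theorem integral_ofCc_leftMul_translate (f g : TwistedCc α μ) :
    ∫ t, ofCc.{w} p α μ ((g.translate t).leftMul (f t)) ∂μ = ofCc.{w} p α μ (f * g) := by
  refine ext_integratedForm fun X _ ν _ R => ?_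
  ext1 ξ
  -- Evaluation $y\mapsto(\pi\rtimes v)(y)\xi$ is bounded, so it passes under the integral and
  -- reduces the identity to multiplicativity of the integrated form.
  let T : FpCrossedProduct.{w} p α μ →L[ℂ] Lp ℂ p ν :=
    LinearMap.mkContinuous
      ((ContinuousLinearMap.apply ℂ (Lp ℂ p ν) ξ).toLinearMap ∘ₗ
        (R.integratedForm μ : FpCrossedProduct.{w} p α μ →ₗ[ℂ] _)) ‖ξ‖ fun y => by
      rw [mul_comm]
      exact (R.integratedForm μ y).le_of_opNorm_le (R.norm_integratedForm_le y) ξ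
  have hT : ∀ y, R.integratedForm μ y ξ = T y := fun _ => rfl
  rw [hT, ← T.integral_comp_comm (integrable_ofCc_leftMul_translate f g)]
  simp only [← hT, R.integratedForm_ofCc, R.integrated_mul, R.integrated_leftMul,
    mul_apply_eq_comp, R.integrated_translate, R.integrated_apply f]

end FpCrossedProduct

end LeftMultipliers

/-! ### A contractive left approximate identity made of functions $\varphi(t)a$. -/

section ApproximateIdentity

variable {G : Type u} {A : Type v} [Group G] [TopologicalSpace G] [IsTopologicalGroup G]
  [LocallyCompactSpace G] [MeasurableSpace G] [BorelSpace G]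
  [NonUnitalNormedRing A] [NormedSpace ℂ A] [IsScalarTower ℂ A A] [SMulCommClass ℂ A A]
  [CompleteSpace A] {α : IsometricAction G A} {μ : Measure G}

/-- A bounded approximate unit converges uniformly on compact sets. -/
theorem Filter.IsApproximateUnit.eventually_forall_norm_mul_sub_le {l : Filter A}
    (hl : l.IsApproximateUnit) (hl1 : ∀ᶠ e in l, ‖e‖ ≤ 1) {K : Set A} (hK : IsCompact K)
    {ε : ℝ} (hε : 0 < ε) : ∀ᶠ e in l, ∀ b ∈ K, ‖e * b - b‖ ≤ ε := by
  refine hK.induction_on (p := fun s => ∀ᶠ e in l, ∀ b ∈ s, ‖e * b - b‖ ≤ ε) (by simp)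
    (fun s t hst h => h.mono fun e he b hb => he b (hst hb)) (fun s t hs ht => ?_) fun b _ => ?_
  · filter_upwards [hs, ht] with e h1 h2 b hb
    exact hb.elim (h1 b) (h2 b)
  · refine ⟨Metric.ball b (ε / 3), mem_nhdsWithin_of_mem_nhds (Metric.ball_mem_nhds b (by positivity)), ?_⟩
    filter_upwards [hl1, (tendsto_iff_norm_sub_tendsto_zero.1 (hl.tendsto_mul_right b)).eventually
      (gt_mem_nhds (show 0 < ε / 3 by positivity))] with e he heb c hc
    have hc' : ‖c - b‖ < ε / 3 := by rwa [Metric.mem_ball, dist_eq_norm] at hc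
    have h1 : ‖e * (c - b)‖ ≤ ‖c - b‖ :=
      (norm_mul_le _ _).trans (mul_le_of_le_one_left (norm_nonneg _) he)
    calc ‖e * c - c‖ = ‖e * (c - b) + (e * b - b) - (c - b)‖ := by
          rw [mul_sub]; congr 1; abel
      _ ≤ ‖e * (c - b)‖ + ‖e * b - b‖ + ‖c - b‖ :=
          (norm_sub_le _ _).trans (add_le_add_left (norm_add_le _ _) _)
      _ ≤ ε := by linarith

/-- Every neighbourhood of the identity carries a bump function of integral one. -/
theorem exists_bump_integral_eq_one [μ.IsHaarMeasure] {U : Set G} (hU : U ∈ 𝓝 (1 : G)) :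
    ∃ φ : C_c(G, ℝ), (∀ t, 0 ≤ φ t) ∧ ∫ t, φ t ∂μ = 1 ∧ ∀ t ∉ U, φ t = 0 := by
  -- `G` is not assumed Hausdorff, so $\{1\}$ need not be closed; its closure is compact and remains
  -- inside the interior of `U`.
  obtain ⟨f, hf1, hf0, hfc, hf⟩ := exists_continuous_one_zero_of_isCompact (isCompact_singleton
    (x := (1 : G))).closure (isOpen_interior (s := U)).isClosed_compl (by
      rw [Set.disjoint_compl_right_iff_subset]
      exact isCompact_singleton.closure_subset_of_isOpen isOpen_interior
        (Set.singleton_subset_iff.2 (mem_interior_iff_mem_nhds.2 hU)))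
  have hpos : 0 < ∫ t, f t ∂μ :=
    f.continuous.integral_pos_of_hasCompactSupport_nonneg_nonzero hfc (fun t => (hf t).1)
      (x := 1) (by rw [hf1 (subset_closure rfl)]; simp)
  refine ⟨⟨⟨fun t => (∫ t, f t ∂μ)⁻¹ * f t, by fun_prop⟩, hfc.mul_left⟩, fun t => ?_, ?_,
    fun t ht => ?_⟩
  · exact mul_nonneg (inv_nonneg.2 hpos.le) (hf t).1
  · change ∫ t, (∫ t, f t ∂μ)⁻¹ * f t ∂μ = 1
    rw [integral_const_mul, inv_mul_cancel₀ hpos.ne']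
  · change _ * f t = 0
    rw [hf0 (fun h => ht (interior_subset h))]
    simp

namespace FpCrossedProduct

variable {p : ℝ≥0∞} [Fact (1 ≤ p)]

theorem tendsto_ofCc_leftMul [IsFiniteMeasureOnCompacts μ] [μ.IsMulLeftInvariant]
    {l : Filter A} (hl : l.IsApproximateUnit)
    (hl1 : ∀ᶠ e in l, ‖e‖ ≤ 1) (f : TwistedCc α μ) :
    Tendsto (fun a => ofCc.{w} p α μ (f.leftMul a)) l (𝓝 (ofCc.{w} p α μ f)) := by
  rw [Metric.tendsto_nhds]
  intro ε hε
  -- The added $1$ keeps the denominator positive even for a null support and makes the final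
  -- estimate strict.
  have hM : 0 < μ.real (tsupport f) + 1 := by positivity
  have hδ : 0 < ε / (μ.real (tsupport f) + 1) := by positivity
  filter_upwards [hl.eventually_forall_norm_mul_sub_le hl1
    (f.hasCompactSupport.isCompact.image f.continuous) hδ] with a ha
  rw [dist_eq_norm, ← map_sub]
  have hfin : μ (tsupport f) < ∞ := f.hasCompactSupport.isCompact.measure_lt_top
  have h0 : ∀ t ∉ tsupport f, ‖(f.leftMul a - f) t‖ = 0 := fun t ht => by
    simp [f.eq_zero_of_notMem ht]
  calc ‖ofCc.{w} p α μ (f.leftMul a - f)‖ ≤ ∫ t, ‖(f.leftMul a - f) t‖ ∂μ :=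
        norm_ofCc_le_integral _
    _ = ∫ t in tsupport f, ‖(f.leftMul a - f) t‖ ∂μ :=
        (setIntegral_eq_integral_of_forall_compl_eq_zero h0).symm
    _ ≤ ∫ _ in tsupport f, ε / (μ.real (tsupport f) + 1) ∂μ :=
        setIntegral_mono_on (TwistedCc.integrable_norm _).integrableOn
          (integrableOn_const hfin.ne) (isClosed_tsupport f).measurableSet
          fun t ht => ha _ ⟨t, ht, rfl⟩
    _ = μ.real (tsupport f) * (ε / (μ.real (tsupport f) + 1)) := by
        rw [setIntegral_const, smul_eq_mul]
    _ < (μ.real (tsupport f) + 1) * (ε / (μ.real (tsupport f) + 1)) :=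
        mul_lt_mul_of_pos_right (lt_add_one _) hδ
    _ = ε := mul_div_cancel₀ _ hM.ne'

variable [μ.IsHaarMeasure]

theorem norm_ofCc_scalarMul_le {φ : C_c(G, ℝ)} (hφ : ∀ t, 0 ≤ φ t) (hφ1 : ∫ t, φ t ∂μ = 1)
    (a : A) : ‖ofCc.{w} p α μ (.scalarMul φ a)‖ ≤ ‖a‖ := by
  refine (norm_ofCc_le_integral _).trans_eq ?_
  have h : ∀ t, ‖(TwistedCc.scalarMul φ a : TwistedCc α μ) t‖ = φ t * ‖a‖ := fun t => by
    rw [TwistedCc.scalarMul_apply, norm_smul, Complex.norm_real, Real.norm_of_nonneg (hφ t)]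
  simp only [h, integral_mul_const, hφ1, one_mul]

/-- The product $(\varphi a)*f=\int\varphi(t)\,a\cdot(t\cdot f)\,d\mu(t)$ is an average for the
probability density $\varphi$, so it lies as close to `f` as the vectors being averaged. -/
theorem norm_ofCc_scalarMul_mul_sub_le {φ : C_c(G, ℝ)} (hφ : ∀ t, 0 ≤ φ t)
    (hφ1 : ∫ t, φ t ∂μ = 1) (a : A) (f : TwistedCc α μ) {ε : ℝ}
    (h : ∀ t, φ t ≠ 0 → ‖ofCc.{w} p α μ ((f.translate t).leftMul a) - ofCc.{w} p α μ f‖ ≤ ε) :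
    ‖ofCc.{w} p α μ (.scalarMul φ a * f) - ofCc.{w} p α μ f‖ ≤ ε := by
  have hφi : Integrable φ μ := φ.continuous.integrable_of_hasCompactSupport φ.hasCompactSupport
  have h1 : ofCc.{w} p α μ f = ∫ t, (φ t : ℂ) • ofCc.{w} p α μ f ∂μ := by
    rw [integral_smul_const, integral_complex_ofReal, hφ1, Complex.ofReal_one, one_smul]
  have h2 : ∫ t, φ t * ε ∂μ = ε := by rw [integral_mul_const, hφ1, one_mul]
  have h3 : Integrable (fun t => (φ t : ℂ) • ofCc.{w} p α μ f) μ := hφi.ofReal.smul_const _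
  rw [← integral_ofCc_leftMul_translate, h1,
    ← integral_sub (integrable_ofCc_leftMul_translate _ _) h3, ← h2]
  refine norm_integral_le_of_norm_le (hφi.mul_const ε) (Eventually.of_forall fun t => ?_)
  rw [TwistedCc.scalarMul_apply, TwistedCc.leftMul_smul, map_smul, ← smul_sub, norm_smul,
    Complex.norm_real, Real.norm_of_nonneg (hφ t)]
  rcases eq_or_ne (φ t) 0 with h0 | h0
  · simp [h0]
  · exact mul_le_mul_of_nonneg_left (h t h0) (hφ t)

/-- The crossed product has a contractive left approximate identity in `C_c(G, A, α)`. -/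
theorem exists_left_approx_identity (hA : HasContractiveApproxIdentity A) :
    ∃ l : Filter (TwistedCc α μ), l.NeBot ∧ (∀ᶠ e in l, ‖ofCc.{w} p α μ e‖ ≤ 1) ∧
      ∀ f, Tendsto (fun e => ofCc.{w} p α μ (e * f)) l (𝓝 (ofCc.{w} p α μ f)) := by
  obtain ⟨l, hl, hl1⟩ := hA
  have := hl.neBot
  have hb : ∀ U : Set G, ∃ φ : C_c(G, ℝ), U ∈ 𝓝 (1 : G) →
      (∀ t, 0 ≤ φ t) ∧ ∫ t, φ t ∂μ = 1 ∧ ∀ t ∉ U, φ t = 0 := fun U => by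
    by_cases hU : U ∈ 𝓝 (1 : G)
    · obtain ⟨φ, hφ⟩ := exists_bump_integral_eq_one (μ := μ) hU
      exact ⟨φ, fun _ => hφ⟩
    · exact ⟨0, fun h => absurd h hU⟩
  choose φ hφ using hb
  -- Neighbourhoods of the identity directed by shrinking. The principal part excludes small sets
  -- that are not neighbourhoods, where `φ` is a meaningless default.
  let N : Filter (Set G) := (𝓝 (1 : G)).smallSets ⊓ 𝓟 {U | U ∈ 𝓝 (1 : G)}
  have hN : N.NeBot := frequently_mem_iff_neBot.1 (frequently_smallSets_mem _)
  refine ⟨(l ×ˢ N).map fun q => .scalarMul (φ q.2) q.1, inferInstance, ?_, fun f => ?_⟩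
  · rw [eventually_map]
    filter_upwards [tendsto_fst.eventually hl1,
      tendsto_snd.eventually (mem_inf_of_right (mem_principal_self _))] with q ha hU
    exact (norm_ofCc_scalarMul_le (hφ _ hU).1 (hφ _ hU).2.1 _).trans ha
  · rw [tendsto_map'_iff, Metric.tendsto_nhds]
    intro ε hε
    have h1 := Metric.tendsto_nhds.1 (tendsto_ofCc_leftMul.{w} (p := p) hl hl1 f) (ε / 4)
      (by positivity)
    have h2 := Metric.tendsto_nhds.1 ((continuous_ofCc_translate.{w} (p := p) f).tendsto 1)
      (ε / 4) (by positivity)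
    rw [TwistedCc.translate_one] at h2
    filter_upwards [tendsto_fst.eventually hl1, tendsto_fst.eventually h1,
      tendsto_snd.eventually (mem_inf_of_left h2.smallSets),
      tendsto_snd.eventually (mem_inf_of_right (mem_principal_self _))] with q ha haf hUf hU
    rw [dist_eq_norm]
    refine (norm_ofCc_scalarMul_mul_sub_le (hφ _ hU).1 (hφ _ hU).2.1 q.1 f
      (ε := ε / 2) fun t ht => ?_).trans_lt (half_lt_self hε)
    have hUt := hUf t (not_imp_comm.1 ((hφ _ hU).2.2 t) ht)
    rw [dist_eq_norm] at hUt haf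
    -- Split $a\cdot(t\cdot f)-f$ as $a\cdot(t\cdot f-f)+(a\cdot f-f)$. Since $\|a\|\le1$, the first
    -- term is small uniformly in $a$, so $a$ and `U` can vary independently.
    have h3 : ‖ofCc.{w} p α μ ((f.translate t - f).leftMul q.1)‖ ≤ ε / 4 := by
      refine (norm_ofCc_leftMul_le _ _).trans ?_
      rw [map_sub]
      exact (mul_le_of_le_one_left (norm_nonneg _) ha).trans hUt.le
    calc _ = ‖ofCc.{w} p α μ ((f.translate t - f).leftMul q.1) +
          (ofCc.{w} p α μ (f.leftMul q.1) - ofCc.{w} p α μ f)‖ := by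
          rw [map_sub, map_sub]; congr 1; abel
      _ ≤ ε / 4 + ε / 4 := (norm_add_le _ _).trans (add_le_add h3 haf.le)
      _ = ε / 2 := by ring

end FpCrossedProduct

end ApproximateIdentity

/-! ### Extending left multipliers to operators and recovering the representation. -/

section Disintegration

variable {G : Type u} {A : Type v} [Group G] [TopologicalSpace G] [IsTopologicalGroup G]
  [LocallyCompactSpace G] [MeasurableSpace G] [BorelSpace G]
  [NonUnitalNormedRing A] [NormedSpace ℂ A] [IsScalarTower ℂ A A] [SMulCommClass ℂ A A]
  [CompleteSpace A] {α : IsometricAction G A} {μ : Measure G} [μ.IsHaarMeasure]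
  {p : ℝ≥0∞} [Fact (1 ≤ p)]

namespace FpCrossedProduct

/-- A linear map on `C_c(G, A, α)` commuting with right multiplications and bounded by `C` for the
norm of the crossed product. -/
structure IsLeftMultiplier (p : ℝ≥0∞) [Fact (1 ≤ p)] (T : TwistedCc α μ →ₗ[ℂ] TwistedCc α μ)
    (C : ℝ) : Prop where
  map_conv : ∀ f g, T (f * g) = T f * g
  bound : ∀ f, ‖ofCc.{w} p α μ (T f)‖ ≤ C * ‖ofCc.{w} p α μ f‖

theorem isLeftMultiplier_leftMul (a : A) :
    IsLeftMultiplier.{w} p (TwistedCc.leftMul a : TwistedCc α μ →ₗ[ℂ] TwistedCc α μ) ‖a‖ :=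
  ⟨TwistedCc.leftMul_conv a, norm_ofCc_leftMul_le a⟩

theorem isLeftMultiplier_translate (t : G) :
    IsLeftMultiplier.{w} p (TwistedCc.translate t : TwistedCc α μ →ₗ[ℂ] TwistedCc α μ) 1 :=
  ⟨TwistedCc.translate_conv t, fun f => by rw [one_mul]; exact norm_ofCc_translate_le t f⟩

variable {E : Type*} [NormedAddCommGroup E] [NormedSpace ℂ E]
  (L : FpCrossedProduct.{w} p α μ →ₙₐ[ℂ] (E →L[ℂ] E))

/-- The linear map `∑ cᵢ (fᵢ, ξᵢ) ↦ ∑ cᵢ L(T fᵢ) ξᵢ`. -/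
noncomputable def combination (T : TwistedCc α μ →ₗ[ℂ] TwistedCc α μ) :
    (TwistedCc α μ × E →₀ ℂ) →ₗ[ℂ] E :=
  Finsupp.linearCombination ℂ fun q => L (ofCc.{w} p α μ (T q.1)) q.2

variable {L}

theorem continuous_of_isContractiveRep (hL : IsContractiveRep L) : Continuous L :=
  AddMonoidHomClass.continuous_of_bound L 1 fun b => by simpa using hL b

theorem continuous_apply_of_isContractiveRep (hL : IsContractiveRep L) (ξ : E) :
    Continuous fun b => L b ξ :=
  (continuous_of_isContractiveRep hL).clm_apply continuous_const

theorem denseRange_combination_id (hL : IsContractiveRep L) (hLn : IsNondegenerateRep L) :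
    DenseRange (combination L LinearMap.id) := by
  let S : Submodule ℂ E := LinearMap.range (combination L LinearMap.id)
  have h : Submodule.span ℂ {η : E | ∃ b ξ, η = L b ξ} ≤ S.topologicalClosure := by
    refine Submodule.span_le.2 ?_
    rintro _ ⟨b, ξ, rfl⟩
    refine denseRange_ofCc.induction_on b
      (S.isClosed_topologicalClosure.preimage (continuous_apply_of_isContractiveRep hL ξ))
      fun f => S.le_topologicalClosure ⟨Finsupp.single (f, ξ) 1, ?_⟩
    simp [combination]
  exact dense_closure.1 (hLn.mono h)

/-- Two operators agreeing on the vectors `L(f)ξ` are equal. -/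
theorem ext_of_isNondegenerateRep (hL : IsContractiveRep L) (hLn : IsNondegenerateRep L)
    {S T : E →L[ℂ] E}
    (h : ∀ f ξ, S (L (ofCc.{w} p α μ f) ξ) = T (L (ofCc.{w} p α μ f) ξ)) : S = T := by
  refine ContinuousLinearMap.coeFn_injective
    ((denseRange_combination_id hL hLn).equalizer S.continuous T.continuous ?_)
  have : S.toLinearMap ∘ₗ combination L LinearMap.id =
      T.toLinearMap ∘ₗ combination L LinearMap.id := by
    ext ⟨f, ξ⟩
    simpa [combination] using h f ξ
  exact congrArg DFunLike.coe this

/-- The key estimate: $L(f)\xi\mapsto L(Tf)\xi$ is a pointwise limit of the operators $L(Te)$, whose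
norms are eventually at most `C`. In particular, a combination that vanishes for the identity
vanishes for `T`, which is well-definedness. -/
theorem norm_combination_le (hA : HasContractiveApproxIdentity A) (hL : IsContractiveRep L)
    {T : TwistedCc α μ →ₗ[ℂ] TwistedCc α μ} {C : ℝ} (hC : 0 ≤ C)
    (hT : IsLeftMultiplier.{w} p T C) (z : TwistedCc α μ × E →₀ ℂ) :
    ‖combination L T z‖ ≤ C * ‖combination L LinearMap.id z‖ := by
  obtain ⟨l, _, hl1, hl⟩ := exists_left_approx_identity.{w} (p := p) (α := α) (μ := μ) hA
  have hTl : ∀ f, Tendsto (fun e => ofCc.{w} p α μ (T e * f)) l (𝓝 (ofCc.{w} p α μ (T f))) := by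
    intro f
    rw [tendsto_iff_norm_sub_tendsto_zero]
    refine squeeze_zero (fun _ => norm_nonneg _) (fun e => ?_)
      (by simpa only [mul_zero] using (tendsto_iff_norm_sub_tendsto_zero.1 (hl f)).const_mul C)
    rw [← hT.map_conv, ← map_sub, ← map_sub, ← map_sub]
    exact hT.bound _
  have h1 : Tendsto (fun e => L (ofCc.{w} p α μ (T e)) (combination L LinearMap.id z)) l
      (𝓝 (combination L T z)) := by
    simp only [combination, Finsupp.linearCombination_apply, Finsupp.sum, map_sum, map_smul,
      LinearMap.id_apply]
    refine tendsto_finsetSum _ fun q _ => Tendsto.const_smul ?_ _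
    have := ((continuous_apply_of_isContractiveRep hL q.2).tendsto _).comp (hTl q.1)
    simpa only [Function.comp_def, map_mul, mul_apply_eq_comp] using this
  refine le_of_tendsto h1.norm ?_
  filter_upwards [hl1] with e he
  refine ContinuousLinearMap.le_of_opNorm_le _ ((hL _).trans ((hT.bound e).trans ?_)) _
  exact mul_le_of_le_one_right hC he

variable [CompleteSpace E]

variable (L) in
/-- The operator on `E` induced by a left multiplier `T`, determined by
`L(f)ξ ↦ L(T f)ξ`. -/
noncomputable def multiplierOp (T : TwistedCc α μ →ₗ[ℂ] TwistedCc α μ) : E →L[ℂ] E :=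
  -- No bound on `T` is required here; the density and norm estimate that give the extension its
  -- meaning enter in `multiplierOp_apply`.
  (combination L T).extendOfNorm (combination L LinearMap.id)

theorem multiplierOp_apply (hA : HasContractiveApproxIdentity A) (hL : IsContractiveRep L)
    (hLn : IsNondegenerateRep L) {T : TwistedCc α μ →ₗ[ℂ] TwistedCc α μ} {C : ℝ} (hC : 0 ≤ C)
    (hT : IsLeftMultiplier.{w} p T C) (f : TwistedCc α μ) (ξ : E) :
    multiplierOp L T (L (ofCc.{w} p α μ f) ξ) = L (ofCc.{w} p α μ (T f)) ξ := by
  have := LinearMap.extendOfNorm_eq (denseRange_combination_id hL hLn)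
    ⟨C, norm_combination_le hA hL hC hT⟩ (Finsupp.single (f, ξ) 1)
  simpa [combination, multiplierOp] using this

theorem norm_multiplierOp_le (hA : HasContractiveApproxIdentity A) (hL : IsContractiveRep L)
    (hLn : IsNondegenerateRep L) {T : TwistedCc α μ →ₗ[ℂ] TwistedCc α μ} {C : ℝ} (hC : 0 ≤ C)
    (hT : IsLeftMultiplier.{w} p T C) : ‖multiplierOp L T‖ ≤ C :=
  LinearMap.opNorm_extendOfNorm_le (denseRange_combination_id hL hLn) hC
    (norm_combination_le hA hL hC hT)

theorem multiplierOp_leftMul_apply (hA : HasContractiveApproxIdentity A) (hL : IsContractiveRep L)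
    (hLn : IsNondegenerateRep L) (a : A) (f : TwistedCc α μ) (ξ : E) :
    multiplierOp L (TwistedCc.leftMul a) (L (ofCc.{w} p α μ f) ξ) =
      L (ofCc.{w} p α μ (f.leftMul a)) ξ :=
  multiplierOp_apply hA hL hLn (norm_nonneg a) (isLeftMultiplier_leftMul a) f ξ

theorem multiplierOp_translate_apply (hA : HasContractiveApproxIdentity A)
    (hL : IsContractiveRep L) (hLn : IsNondegenerateRep L) (t : G) (f : TwistedCc α μ) (ξ : E) :
    multiplierOp L (TwistedCc.translate t) (L (ofCc.{w} p α μ f) ξ) =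
      L (ofCc.{w} p α μ (f.translate t)) ξ :=
  multiplierOp_apply hA hL hLn zero_le_one (isLeftMultiplier_translate t) f ξ

theorem norm_multiplierOp_translate_le (hA : HasContractiveApproxIdentity A)
    (hL : IsContractiveRep L) (hLn : IsNondegenerateRep L) (t : G) (ξ : E) :
    ‖multiplierOp L (TwistedCc.translate t) ξ‖ ≤ ‖ξ‖ := by
  simpa using (multiplierOp L (TwistedCc.translate t)).le_of_opNorm_le
    (norm_multiplierOp_le hA hL hLn zero_le_one (isLeftMultiplier_translate t)) ξ

theorem multiplierOp_translate_one (hA : HasContractiveApproxIdentity A)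
    (hL : IsContractiveRep L) (hLn : IsNondegenerateRep L) :
    multiplierOp L (TwistedCc.translate 1) = 1 :=
  ext_of_isNondegenerateRep hL hLn fun f ξ => by
    rw [multiplierOp_translate_apply hA hL hLn, TwistedCc.translate_one]; rfl

theorem multiplierOp_translate_mul (hA : HasContractiveApproxIdentity A)
    (hL : IsContractiveRep L) (hLn : IsNondegenerateRep L) (s t : G) :
    multiplierOp L (TwistedCc.translate (s * t)) =
      multiplierOp L (TwistedCc.translate s) * multiplierOp L (TwistedCc.translate t) :=
  ext_of_isNondegenerateRep hL hLn fun f ξ => by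
    simp only [mul_apply_eq_comp, multiplierOp_translate_apply hA hL hLn,
      TwistedCc.translate_mul]

/-- The representation of the coefficient algebra induced by `L`. -/
noncomputable def coefficientRep (hA : HasContractiveApproxIdentity A) (hL : IsContractiveRep L)
    (hLn : IsNondegenerateRep L) : A →ₙₐ[ℂ] (E →L[ℂ] E) where
  toFun a := multiplierOp L (TwistedCc.leftMul a)
  map_smul' c a := ext_of_isNondegenerateRep hL hLn fun f ξ => by
    simp only [multiplierOp_leftMul_apply hA hL hLn, TwistedCc.leftMul_smul, map_smul,
      MonoidHom.id_apply, _root_.smul_apply]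
  map_zero' := ext_of_isNondegenerateRep hL hLn fun f ξ => by
    simp only [multiplierOp_leftMul_apply hA hL hLn, TwistedCc.leftMul_zero, map_zero,
      _root_.zero_apply]
  map_add' a b := ext_of_isNondegenerateRep hL hLn fun f ξ => by
    simp only [multiplierOp_leftMul_apply hA hL hLn, TwistedCc.leftMul_add, map_add,
      _root_.add_apply]
  map_mul' a b := ext_of_isNondegenerateRep hL hLn fun f ξ => by
    simp only [multiplierOp_leftMul_apply hA hL hLn, TwistedCc.leftMul_mul, mul_apply_eq_comp]

theorem coefficientRep_apply (hA : HasContractiveApproxIdentity A) (hL : IsContractiveRep L)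
    (hLn : IsNondegenerateRep L) (a : A) (f : TwistedCc α μ) (ξ : E) :
    coefficientRep hA hL hLn a (L (ofCc.{w} p α μ f) ξ) = L (ofCc.{w} p α μ (f.leftMul a)) ξ :=
  multiplierOp_leftMul_apply hA hL hLn a f ξ

theorem isContractiveRep_coefficientRep (hA : HasContractiveApproxIdentity A)
    (hL : IsContractiveRep L) (hLn : IsNondegenerateRep L) :
    IsContractiveRep (coefficientRep hA hL hLn) := fun a =>
  norm_multiplierOp_le hA hL hLn (norm_nonneg a) (isLeftMultiplier_leftMul a)

/-- Along the approximate identity of `A`, $\pi(a)L(f)\xi=L(a\cdot f)\xi\to L(f)\xi$, and the limits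
span a dense subspace. -/
theorem isNondegenerateRep_coefficientRep (hA : HasContractiveApproxIdentity A)
    (hL : IsContractiveRep L) (hLn : IsNondegenerateRep L) :
    IsNondegenerateRep (coefficientRep hA hL hLn) := by
  obtain ⟨l, hl, hl1⟩ := id hA
  have := hl.neBot
  set S := Submodule.span ℂ {η : E | ∃ a ξ, η = coefficientRep hA hL hLn a ξ} with hS
  have h : LinearMap.range (combination L LinearMap.id) ≤ S.topologicalClosure := by
    rw [combination, Finsupp.range_linearCombination, Submodule.span_le]
    rintro _ ⟨⟨f, ξ⟩, rfl⟩
    have h1 := ((continuous_apply_of_isContractiveRep hL ξ).tendsto _).comp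
      (tendsto_ofCc_leftMul.{w} (p := p) hl hl1 f)
    refine mem_closure_of_tendsto h1 (Eventually.of_forall fun a => ?_)
    exact Submodule.subset_span ⟨a, _, (coefficientRep_apply hA hL hLn a f ξ).symm⟩
  exact dense_closure.1 (Dense.mono h (denseRange_combination_id hL hLn))

/-- The isometric representation of the group induced by `L`. -/
noncomputable def groupRep (hA : HasContractiveApproxIdentity A) (hL : IsContractiveRep L)
    (hLn : IsNondegenerateRep L) : G →* (E ≃ₗᵢ[ℂ] E) :=
  have hinv : ∀ t ξ, multiplierOp L (TwistedCc.translate t⁻¹)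
      (multiplierOp L (TwistedCc.translate t) ξ) = ξ := fun t ξ => by
    rw [← mul_apply_eq_comp, ← multiplierOp_translate_mul hA hL hLn, inv_mul_cancel,
      multiplierOp_translate_one hA hL hLn]
    rfl
  { toFun := fun t =>
      { toLinearEquiv := LinearEquiv.ofLinearMap
          (multiplierOp L (TwistedCc.translate t)).toLinearMap
          (multiplierOp L (TwistedCc.translate t⁻¹)).toLinearMap
          (LinearMap.ext fun ξ => by simpa using hinv t⁻¹ ξ)
          (LinearMap.ext fun ξ => hinv t ξ)
        norm_map' := fun ξ => by
          -- The operators for $t$ and $t^{-1}$ are mutually inverse contractions, hence isometries.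
          refine le_antisymm (norm_multiplierOp_translate_le hA hL hLn t ξ) ?_
          have := norm_multiplierOp_translate_le hA hL hLn t⁻¹
            (multiplierOp L (TwistedCc.translate t) ξ)
          rwa [hinv] at this }
    map_one' := LinearIsometryEquiv.ext fun ξ =>
      congrArg (fun T : E →L[ℂ] E => T ξ) (multiplierOp_translate_one hA hL hLn)
    map_mul' := fun s t => LinearIsometryEquiv.ext fun ξ =>
      congrArg (fun T : E →L[ℂ] E => T ξ) (multiplierOp_translate_mul hA hL hLn s t) }

theorem groupRep_apply (hA : HasContractiveApproxIdentity A) (hL : IsContractiveRep L)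
    (hLn : IsNondegenerateRep L) (t : G) (f : TwistedCc α μ) (ξ : E) :
    groupRep hA hL hLn t (L (ofCc.{w} p α μ f) ξ) = L (ofCc.{w} p α μ (f.translate t)) ξ :=
  multiplierOp_translate_apply hA hL hLn t f ξ

/-- On combinations of vectors $L(f)\eta$ this follows from continuity of $t\mapsto t\cdot f$ into
the crossed product; density and isometry give the rest by an $\varepsilon/3$ argument. -/
theorem continuous_groupRep (hA : HasContractiveApproxIdentity A) (hL : IsContractiveRep L)
    (hLn : IsNondegenerateRep L) (ξ : E) : Continuous fun t => groupRep hA hL hLn t ξ := by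
  rw [continuous_iff_continuousAt]
  intro t₀
  have hcomb : ∀ z, Continuous fun t =>
      groupRep hA hL hLn t (combination L LinearMap.id z) := fun z => by
    simp only [combination, Finsupp.linearCombination_apply, Finsupp.sum, map_sum, map_smul,
      LinearMap.id_apply, groupRep_apply]
    exact continuous_finsetSum _ fun q _ => Continuous.const_smul
      ((continuous_apply_of_isContractiveRep hL q.2).comp (continuous_ofCc_translate q.1)) _
  rw [ContinuousAt, Metric.tendsto_nhds]
  intro ε hε
  obtain ⟨z, hz⟩ := Metric.denseRange_iff.1 (denseRange_combination_id hL hLn) ξ (ε / 3)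
    (by positivity)
  filter_upwards [Metric.tendsto_nhds.1 ((hcomb z).tendsto t₀) (ε / 3) (by positivity)] with t ht
  have h1 := (groupRep hA hL hLn t).isometry.dist_eq ξ (combination L LinearMap.id z)
  have h2 := (groupRep hA hL hLn t₀).isometry.dist_eq (combination L LinearMap.id z) ξ
  rw [dist_comm _ ξ] at h2
  have h3 := dist_triangle4 (groupRep hA hL hLn t ξ)
    (groupRep hA hL hLn t (combination L LinearMap.id z))
    (groupRep hA hL hLn t₀ (combination L LinearMap.id z)) (groupRep hA hL hLn t₀ ξ)
  linarith

theorem covariant_groupRep (hA : HasContractiveApproxIdentity A) (hL : IsContractiveRep L)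
    (hLn : IsNondegenerateRep L) (t : G) (a : A) (ξ : E) :
    groupRep hA hL hLn t (coefficientRep hA hL hLn a (groupRep hA hL hLn t⁻¹ ξ)) =
      coefficientRep hA hL hLn (α.aut t a) ξ := by
  have h : multiplierOp L (TwistedCc.translate t) * (multiplierOp L (TwistedCc.leftMul a) *
      multiplierOp L (TwistedCc.translate t⁻¹)) =
      multiplierOp L (TwistedCc.leftMul (α.aut t a)) :=
    ext_of_isNondegenerateRep hL hLn fun f η => by
      simp only [mul_apply_eq_comp, multiplierOp_translate_apply hA hL hLn,
        multiplierOp_leftMul_apply hA hL hLn, TwistedCc.translate_leftMul_translate_inv]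
  exact congrArg (fun T : E →L[ℂ] E => T ξ) h

/-- The covariant representation from which a nondegenerate contractive representation of the
crossed product is integrated. -/
noncomputable def covariantRep {X : Type*} [MeasurableSpace X] {ν : Measure X}
    {L : FpCrossedProduct.{w} p α μ →ₙₐ[ℂ] (Lp ℂ p ν →L[ℂ] Lp ℂ p ν)}
    (hA : HasContractiveApproxIdentity A) (hL : IsContractiveRep L)
    (hLn : IsNondegenerateRep L) : CovariantRep p α ν where
  π := coefficientRep hA hL hLn
  contractive := isContractiveRep_coefficientRep hA hL hLn
  nondegenerate := isNondegenerateRep_coefficientRep hA hL hLn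
  v := groupRep hA hL hLn
  continuous_v := continuous_groupRep hA hL hLn
  covariant := covariant_groupRep hA hL hLn

/-- On a vector $L(g)\xi$, both sides equal $L(f*g)\xi$, once convolution is written as an integral
of multipliers applied to `g`. -/
theorem integrated_covariantRep {X : Type*} [MeasurableSpace X] {ν : Measure X}
    {L : FpCrossedProduct.{w} p α μ →ₙₐ[ℂ] (Lp ℂ p ν →L[ℂ] Lp ℂ p ν)}
    (hA : HasContractiveApproxIdentity A) (hL : IsContractiveRep L)
    (hLn : IsNondegenerateRep L) (f : TwistedCc α μ) :
    (covariantRep hA hL hLn).integrated f = L (ofCc.{w} p α μ f) := by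
  refine ext_of_isNondegenerateRep hL hLn fun g ξ => ?_
  let T : FpCrossedProduct.{w} p α μ →L[ℂ] Lp ℂ p ν :=
    { toLinearMap := (ContinuousLinearMap.apply ℂ (Lp ℂ p ν) ξ).toLinearMap ∘ₗ
        (L : FpCrossedProduct.{w} p α μ →ₗ[ℂ] _)
      cont := continuous_apply_of_isContractiveRep hL ξ }
  have hT : ∀ y, L y ξ = T y := fun _ => rfl
  have h : ∀ t, (covariantRep hA hL hLn).π (f t)
      ((covariantRep hA hL hLn).v t (L (ofCc.{w} p α μ g) ξ)) =
      L (ofCc.{w} p α μ ((g.translate t).leftMul (f t))) ξ := fun t => by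
    change coefficientRep hA hL hLn (f t) (groupRep hA hL hLn t _) = _
    rw [groupRep_apply, coefficientRep_apply]
  rw [CovariantRep.integrated_apply, ← mul_apply_eq_comp, ← map_mul, ← map_mul,
    ← integral_ofCc_leftMul_translate]
  simp only [h]
  simp only [hT]
  exact T.integral_comp_comm (integrable_ofCc_leftMul_translate f g)

end FpCrossedProduct

end Disintegration

theorem theorem2p1 {G : Type u} [Group G] [TopologicalSpace G] [IsTopologicalGroup G]
    [LocallyCompactSpace G] [MeasurableSpace G] [BorelSpace G]
    (μ : Measure G) [μ.IsHaarMeasure]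
    (p : ℝ≥0∞) [Fact (1 ≤ p)] (hp : p ≠ ∞)
    {A : Type v} [NonUnitalNormedRing A] [NormedSpace ℂ A] [IsScalarTower ℂ A A]
    [SMulCommClass ℂ A A] [CompleteSpace A]
    (hA : IsLpOperatorAlgebra.{x} p A) (hA_unit : HasContractiveApproxIdentity A)
    (α : IsometricAction G A)
    {X : Type w} [MeasurableSpace X] (ν : Measure X) [SigmaFinite ν]
    (L : FpCrossedProduct.{w} p α μ →ₙₐ[ℂ] (Lp ℂ p ν →L[ℂ] Lp ℂ p ν))
    (hL_contractive : IsContractiveRep L) (hL_nondegenerate : IsNondegenerateRep L) :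
    ∃ R : CovariantRep p α ν, L = R.integratedForm μ := by
  refine ⟨FpCrossedProduct.covariantRep hA_unit hL_contractive hL_nondegenerate, ?_⟩
  ext1 y
  refine FpCrossedProduct.denseRange_ofCc.induction_on y
    (isClosed_eq (FpCrossedProduct.continuous_of_isContractiveRep hL_contractive)
      (CovariantRep.continuous_integratedForm _)) fun f => ?_
  rw [CovariantRep.integratedForm_ofCc, FpCrossedProduct.integrated_covariantRep]
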